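/- Let $M$ be a finite (geometric) simplicial complex in $\mathbb{R}^d$ and let $k\ge 0$. For $v\in S^{d-1}$ let $M(v)$ be the filtration of $M$ by height in direction $v$, where $M(v)_r$ $(r\in\mathbb{R})$ is the subcomplex of all simplices $\Delta$ of $M$ with $x\cdot v\le r$ for all $x\in\Delta$. Let $X_k(M,v)$ be its $k$-th persistence diagram for simplicial homology with coefficients in $\mathbb{Z}/2$: the multiset of points $(a,b)$, $a\in\mathbb{R}$, $b\in\mathbb{R}\cup\{\infty\}$, $a<b$, in which $(a,b)$ has multiplicity equal to the dimension of the space of $k$-dimensional homology classes born at $a$ and dying at $b$ ($b=\infty$ for classes that never die), together with countably infinitely many copies of the diagonal $\{(t,t):t\in\mathbb{R}\}$. (The dimension is that of $D_b/D_{<b}$. Here, for $c\ge a$, $D_c\subseteq H_k(M(v)_a)$ is the space of classes whose image in $H_k(M(v)_c)$ lies in the span of the images of all $H_k(M(v)_{a'})$ with $a'<a$; $D_\infty=H_k(M(v)_a)$; and $D_{<b}$ is the span of the $D_c$ with $a\le c<b$.) For persistence diagrams $X,Y$ let $$d(X,Y)=\inf_{\phi}\sum_{x\in X}\|x-\phi(x)\|_1\in[0,\infty],$$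 the infimum being over all bijections $\phi$ from the points of $X$ to the points of $Y$ (points of the diagonal copies included), where $\|(a,b)-(a',b')\|_1=|a-a'|+|b-b'|$ with $|\infty-\infty|=0$ and $|\infty-b|=\infty$ for $b\in\mathbb{R}$. Then the map $v\mapsto X_k(M,v)$ on $S^{d-1}$ is Lipschitz, and hence continuous, with respect to $d$. More precisely, there are finite $N$ and $K$ such that every $X_k(M,v)$, $v\in S^{d-1}$, has at most $N$ off-diagonal points (counted with multiplicity) and $\|x\|_2\le K$ for every point $x$ of $M$; and for any such $N$ and $K$ $$d(X_k(M,v_1),X_k(M,v_2))\le 2NK\,\|v_1-v_2\|_2\qquad\text{for all } v_1,v_2\in S^{d-1}.$$ -/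

import Mathlib

set_option maxSynthPendingDepth 3

open scoped ENNReal NNReal

noncomputable section

namespace PHT

/-! ### Simplicial homology with coefficients in `ℤ/2` -/

section Homology

variable {V : Type*}

open Classical in
/-- The simplicial boundary over `ℤ/2`: a simplex (given by its set of vertices) is sent to the
sum of its codimension-one faces. The boundary of a vertex is `0` (homology is not reduced), and
the signs of the integral formula play no role modulo `2`. -/
def boundary : (Finset V →₀ ZMod 2) →ₗ[ZMod 2] (Finset V →₀ ZMod 2) :=
  Finsupp.linearCombination (ZMod 2) fun s : Finset V =>
    ∑ x ∈ s with (s.erase x).Nonempty, Finsupp.single (s.erase x) (1 : ZMod 2)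

/-- `C_k(L)`: formal `ℤ/2`-linear combinations of the `k`-simplices of `L`. -/
def chains (L : PreAbstractSimplicialComplex V) (k : ℕ) : Submodule (ZMod 2) (Finset V →₀ ZMod 2) :=
  Finsupp.supported (ZMod 2) (ZMod 2) {s | s ∈ L.faces ∧ s.card = k + 1}

/-- `Z_k(L)`, the kernel of the boundary map on `C_k(L)`. -/
def cycles (L : PreAbstractSimplicialComplex V) (k : ℕ) : Submodule (ZMod 2) (Finset V →₀ ZMod 2) :=
  chains L k ⊓ LinearMap.ker boundary

/-- `B_k(L)`, the image of the boundary map on `C_{k+1}(L)`. -/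
def boundaries (L : PreAbstractSimplicialComplex V) (k : ℕ) :
    Submodule (ZMod 2) (Finset V →₀ ZMod 2) :=
  (chains L (k + 1)).map boundary

/-- `H_k(L) = Z_k(L) / B_k(L)`. -/
abbrev Homology (L : PreAbstractSimplicialComplex V) (k : ℕ) : Type _ :=
  cycles L k ⧸ (boundaries L k).submoduleOf (cycles L k)

lemma chains_mono {L L' : PreAbstractSimplicialComplex V} (h : L ≤ L') (k : ℕ) :
    chains L k ≤ chains L' k :=
  Finsupp.supported_mono fun _ hs => ⟨h hs.1, hs.2⟩

lemma cycles_mono {L L' : PreAbstractSimplicialComplex V} (h : L ≤ L') (k : ℕ) :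
    cycles L k ≤ cycles L' k :=
  inf_le_inf_right _ (chains_mono h k)

lemma boundaries_mono {L L' : PreAbstractSimplicialComplex V} (h : L ≤ L') (k : ℕ) :
    boundaries L k ≤ boundaries L' k :=
  Submodule.map_mono (chains_mono h (k + 1))

/-- The map `H_k(L) → H_k(L')` induced by an inclusion `L ≤ L'`. -/
def homologyMap {L L' : PreAbstractSimplicialComplex V} (h : L ≤ L') (k : ℕ) :
    Homology L k →ₗ[ZMod 2] Homology L' k :=
  Submodule.mapQ _ _ (Submodule.inclusion (cycles_mono h k))
    fun _ hx => boundaries_mono h k hx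

end Homology

/-! ### Persistence diagrams and the `1`-Wasserstein distance -/

/-- The points `(a, b)` strictly above the diagonal; the death time `b` may be `∞ = ⊤`. -/
abbrev UpperPlane : Type := {p : ℝ × WithTop ℝ // (p.1 : WithTop ℝ) < p.2}

/-- A persistence diagram, given by the multiplicities of its off-diagonal points. The copies of
the diagonal, which are the same in every diagram, are added in `Points`. -/
structure PersistenceDiagram where
  mult : UpperPlane → ℕ

namespace PersistenceDiagram

/-- The off-diagonal points of a diagram, repeated according to multiplicity. -/
abbrev OffDiagonal (X : PersistenceDiagram) : Type := Σ p : UpperPlane, Fin (X.mult p)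

/-- All points of a diagram: the off-diagonal points, together with countably many copies of
the diagonal (`(t, n)` is the point `(t, t)` of the `n`-th copy). -/
abbrev Points (X : PersistenceDiagram) : Type := X.OffDiagonal ⊕ (ℝ × ℕ)

/-- The location in the extended plane of a point of a diagram. -/
def pos {X : PersistenceDiagram} : X.Points → ℝ × WithTop ℝ
  | Sum.inl x => x.1.1
  | Sum.inr t => (t.1, (t.1 : WithTop ℝ))

/-- The distance `|b - b'|` between two death times: `∞` is at distance `0` from itself and at
infinite distance from every real number. -/
def deathDist : WithTop ℝ → WithTop ℝ → ℝ≥0∞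
  | ⊤, ⊤ => 0
  | ⊤, (_ : ℝ) => ⊤
  | (_ : ℝ), ⊤ => ⊤
  | (b : ℝ), (b' : ℝ) => edist b b'

/-- The `ℓ¹` distance `|a - a'| + |b - b'|` between points of the extended plane. -/
def l1Dist (p q : ℝ × WithTop ℝ) : ℝ≥0∞ := edist p.1 q.1 + deathDist p.2 q.2

/-- The `1`-Wasserstein distance: the infimum, over the bijections `φ` between all points of `X`
and all points of `Y` (diagonal included), of `∑ ‖x - φ x‖₁`. -/
def d₁ (X Y : PersistenceDiagram) : ℝ≥0∞ :=
  ⨅ φ : X.Points ≃ Y.Points, ∑' x : X.Points, l1Dist (pos x) (pos (φ x))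

lemma l1Dist_self (p : ℝ × WithTop ℝ) : l1Dist p p = 0 := by
  obtain ⟨a, b⟩ := p
  cases b <;> simp [l1Dist, deathDist]

lemma l1Dist_comm (p q : ℝ × WithTop ℝ) : l1Dist p q = l1Dist q p := by
  obtain ⟨a, b⟩ := p
  obtain ⟨a', b'⟩ := q
  cases b <;> cases b' <;> simp [l1Dist, deathDist, edist_comm]

lemma l1Dist_triangle (p q r : ℝ × WithTop ℝ) : l1Dist p r ≤ l1Dist p q + l1Dist q r := by
  have h : deathDist p.2 r.2 ≤ deathDist p.2 q.2 + deathDist q.2 r.2 := by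
    generalize p.2 = b
    generalize q.2 = b'
    generalize r.2 = b''
    cases b <;> cases b' <;> cases b'' <;> simp [deathDist, edist_triangle]
  calc l1Dist p r ≤ (edist p.1 q.1 + edist q.1 r.1) + (deathDist p.2 q.2 + deathDist q.2 r.2) :=
        add_le_add (edist_triangle _ _ _) h
    _ = l1Dist p q + l1Dist q r := by unfold l1Dist; ring

/-- The space of persistence diagrams carries the (extended) metric `d₁`. -/
instance : PseudoEMetricSpace PersistenceDiagram where
  edist := d₁
  edist_self X := by
    refine le_antisymm ((iInf_le _ (Equiv.refl _)).trans ?_) (zero_le)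
    simp [l1Dist_self]
  edist_comm := by
    have key : ∀ X Y : PersistenceDiagram, d₁ X Y ≤ d₁ Y X := fun X Y => by
      refine le_iInf fun φ => (iInf_le _ φ.symm).trans (le_of_eq ?_)
      rw [← φ.tsum_eq]
      simp [l1Dist_comm]
    exact fun X Y => le_antisymm (key X Y) (key Y X)
  edist_triangle X Y Z := by
    refine ENNReal.le_iInf_add_iInf fun φ ψ => (iInf_le _ (φ.trans ψ)).trans ?_
    rw [← φ.tsum_eq (fun y => l1Dist (pos y) (pos (ψ y))), ← ENNReal.tsum_add]
    exact ENNReal.tsum_le_tsum fun x => l1Dist_triangle _ _ _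

lemma edist_def (X Y : PersistenceDiagram) : edist X Y = d₁ X Y := rfl

end PersistenceDiagram

/-! ### The persistence diagram of a filtration -/

section Persistence

variable {V : Type*} (F : ℝ →o PreAbstractSimplicialComplex V) (k : ℕ)

/-- The classes of `H_k(F a)` which at time `b ≥ a` come from before `a`: their image in `H_k(F b)`
lies in the subspace of the images of `H_k(F a')`, `a' < a`. In particular this holds for the
classes that are `0` in `H_k(F b)`. -/
def deadAt {a b : ℝ} (hab : a ≤ b) : Submodule (ZMod 2) (Homology (F a) k) :=
  (⨆ a' : Set.Iio a,
      LinearMap.range (homologyMap (F.monotone ((le_of_lt a'.2).trans hab)) k)).comap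
    (homologyMap (F.monotone hab) k)

/-- The classes of `H_k(F a)` that die at or before `b`; for `b = ∞` these are all classes. -/
def deadBy (a : ℝ) : (b : WithTop ℝ) → (a : WithTop ℝ) < b → Submodule (ZMod 2) (Homology (F a) k)
  | ⊤, _ => ⊤
  | (_ : ℝ), h => deadAt F k (WithTop.coe_lt_coe.1 h).le

/-- The classes of `H_k(F a)` that are not born at `a`, or die strictly before `b`. -/
def deadBefore (a : ℝ) (b : WithTop ℝ) : Submodule (ZMod 2) (Homology (F a) k) :=
  ⨆ c : {c : ℝ // a ≤ c ∧ (c : WithTop ℝ) < b}, deadAt F k c.2.1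

/-- The `k`-th persistence diagram of a filtration: the multiplicity of `(a, b)` is the dimension
of the space of `k`-dimensional homology classes that are born at time `a` and die at time `b`.
(Births at `-∞` are not recorded: the filtrations used below are empty at all sufficiently
small times.) -/
def persistenceDiagram : PersistenceDiagram where
  mult p := Module.finrank (ZMod 2)
    (deadBy F k p.1.1 p.1.2 p.2 ⧸
      (deadBefore F k p.1.1 p.1.2).submoduleOf (deadBy F k p.1.1 p.1.2 p.2))

end Persistence

/-! ### Height filtrations -/

variable {d : ℕ}

/-- The filtration `M(v)` of `M` by height in direction `v`: the subcomplex at time `r` consists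
of the simplices `Δ` of `M` with `x · v ≤ r` for all `x ∈ Δ`. -/
def heightFiltration (M : Geometry.SimplicialComplex ℝ (EuclideanSpace ℝ (Fin d)))
    (v : EuclideanSpace ℝ (Fin d)) : ℝ →o PreAbstractSimplicialComplex (EuclideanSpace ℝ (Fin d)) where
  toFun r :=
    { faces := {s | s ∈ M.faces ∧ ∀ x ∈ convexHull ℝ (s : Set (EuclideanSpace ℝ (Fin d))),
        inner ℝ x v ≤ r}
      isRelLowerSet_faces := fun {_} hs =>
        ⟨M.nonempty_of_mem_faces hs.1, fun _ hts ht =>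
          ⟨M.down_closed hs.1 hts ht, fun x hx =>
            hs.2 x (convexHull_mono (Finset.coe_subset.2 hts) hx)⟩⟩ }
  monotone' _ _ hr _ hs := ⟨hs.1, fun x hx => (hs.2 x hx).trans hr⟩

/-- `X_k(M, v)`, the `k`-th persistence diagram of the height filtration in direction `v`. -/
def heightDiagram (M : Geometry.SimplicialComplex ℝ (EuclideanSpace ℝ (Fin d))) (k : ℕ)
    (v : EuclideanSpace ℝ (Fin d)) : PersistenceDiagram :=
  persistenceDiagram (heightFiltration M v) k

end PHT

end

open scoped ENNReal NNReal

noncomputable section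

namespace PHT

/-! ### Multiplicities as alternating sums of ranks in homology. -/

section RankFormula

variable {V : Type*}

lemma homologyMap_comp {L L' L'' : PreAbstractSimplicialComplex V} (h : L ≤ L') (h' : L' ≤ L'')
    (k : ℕ) : homologyMap h' k ∘ₗ homologyMap h k = homologyMap (h.trans h') k := by
  apply Submodule.linearMap_qext
  ext x
  rfl

lemma finite_homology {L : PreAbstractSimplicialComplex V} (hL : L.faces.Finite) (k : ℕ) :
    Module.Finite (ZMod 2) (Homology L k) := by
  have hfin : {s | s ∈ L.faces ∧ s.card = k + 1}.Finite := hL.subset fun _ h => h.1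
  have := hfin.to_subtype
  have : Module.Finite (ZMod 2) (chains L k) :=
    Module.Finite.equiv (Finsupp.supportedEquivFinsupp {s | s ∈ L.faces ∧ s.card = k + 1}).symm
  have : Module.Finite (ZMod 2) (cycles L k) :=
    Submodule.finiteDimensional_of_le (inf_le_left : cycles L k ≤ chains L k)
  infer_instance

open Classical in
/-- The rank of `H_k(L) → H_k(L')` for an inclusion `L ≤ L'`. -/
def homologyRank (k : ℕ) (L L' : PreAbstractSimplicialComplex V) : ℕ :=
  if h : L ≤ L' then Module.finrank (ZMod 2) (LinearMap.range (homologyMap h k)) else 0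

lemma homologyRank_of_le {L L' : PreAbstractSimplicialComplex V} (h : L ≤ L') (k : ℕ) :
    homologyRank k L L' = Module.finrank (ZMod 2) (LinearMap.range (homologyMap h k)) :=
  dif_pos h

/-- Rank-nullity for `q` and for its restriction to the preimage: both have kernel `ker q`, and the
restriction has image `range (q ∘ₗ p)`. -/
lemma finrank_comap_range_comp {K A A' B : Type*} [Field K] [AddCommGroup A] [Module K A]
    [AddCommGroup A'] [Module K A'] [AddCommGroup B] [Module K B] [FiniteDimensional K A']
    (p : A →ₗ[K] A') (q : A' →ₗ[K] B) :
    Module.finrank K ((LinearMap.range (q ∘ₗ p)).comap q) + Module.finrank K (LinearMap.range q) =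
      Module.finrank K A' + Module.finrank K (LinearMap.range (q ∘ₗ p)) := by
  set D := (LinearMap.range (q ∘ₗ p)).comap q with hD
  have h1 := LinearMap.finrank_range_add_finrank_ker (q.domRestrict D)
  have h2 := LinearMap.finrank_range_add_finrank_ker q
  have h3 : LinearMap.range (q.domRestrict D) = LinearMap.range (q ∘ₗ p) := by
    rw [LinearMap.range_domRestrict, hD, Submodule.map_comap_eq, inf_eq_right]
    exact LinearMap.range_comp_le_range _ _
  have h4 : Module.finrank K (LinearMap.ker (q.domRestrict D)) =
      Module.finrank K (LinearMap.ker q) := by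
    rw [LinearMap.ker_domRestrict]
    exact LinearEquiv.finrank_eq (Submodule.submoduleOfEquivOfLe (Submodule.comap_mono bot_le))
  rw [h3, h4] at h1
  omega

lemma finrank_quotient_submoduleOf {K A : Type*} [Field K] [AddCommGroup A] [Module K A]
    [FiniteDimensional K A] {E D : Submodule K A} (h : E ≤ D) :
    Module.finrank K (D ⧸ E.submoduleOf D) + Module.finrank K E = Module.finrank K D := by
  rw [← Submodule.finrank_quotient_add_finrank (E.submoduleOf D),
    LinearEquiv.finrank_eq (Submodule.submoduleOfEquivOfLe h)]

variable (F : ℝ →o PreAbstractSimplicialComplex V) (k : ℕ)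

lemma deadAt_mono {a b b' : ℝ} (hab : a ≤ b) (hab' : a ≤ b') (h : F b ≤ F b') :
    deadAt F k hab ≤ deadAt F k hab' := by
  intro x hx
  rw [deadAt, Submodule.mem_comap] at hx ⊢
  have h1 := Submodule.mem_map_of_mem (f := homologyMap h k) hx
  rw [Submodule.map_iSup, ← LinearMap.comp_apply, homologyMap_comp] at h1
  simpa only [← LinearMap.range_comp, homologyMap_comp] using h1

/-- The supremum over all times before `a` is attained at `a'`. -/
lemma deadAt_eq_comap_range {a a' b : ℝ} (hab : a ≤ b) (ha' : a' < a)
    (h : ∀ c < a, F c ≤ F a') :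
    deadAt F k hab = (LinearMap.range (homologyMap (F.monotone hab) k ∘ₗ
      homologyMap (F.monotone ha'.le) k)).comap (homologyMap (F.monotone hab) k) := by
  rw [deadAt, homologyMap_comp]
  congr 1
  apply le_antisymm
  · refine iSup_le fun c => ?_
    rintro _ ⟨x, rfl⟩
    exact ⟨homologyMap (h c c.2) k x, LinearMap.congr_fun
      (homologyMap_comp (h c c.2) (F.monotone (ha'.le.trans hab)) k) x⟩
  · refine le_iSup_of_le (⟨a', ha'⟩ : Set.Iio a) ?_
    rintro _ ⟨x, rfl⟩
    exact ⟨x, rfl⟩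

lemma deadBefore_eq_deadAt {a c : ℝ} {b : WithTop ℝ} (hac : a ≤ c) (hc : (c : WithTop ℝ) < b)
    (h : ∀ c' : ℝ, (c' : WithTop ℝ) < b → F c' ≤ F c) :
    deadBefore F k a b = deadAt F k hac :=
  le_antisymm (iSup_le fun c' => deadAt_mono F k c'.2.1 hac (h c' c'.2.2))
    (le_iSup (fun c' : {c : ℝ // a ≤ c ∧ (c : WithTop ℝ) < b} => deadAt F k c'.2.1) ⟨c, hac, hc⟩)

lemma finrank_deadAt {a a' b : ℝ} (hfin : (F a).faces.Finite) (hab : a ≤ b) (ha' : a' < a)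
    (h : ∀ c < a, F c ≤ F a') :
    Module.finrank (ZMod 2) (deadAt F k hab) + homologyRank k (F a) (F b) =
      Module.finrank (ZMod 2) (Homology (F a) k) + homologyRank k (F a') (F b) := by
  have := finite_homology hfin k
  rw [deadAt_eq_comap_range F k hab ha' h, homologyRank_of_le (F.monotone hab),
    finrank_comap_range_comp, homologyMap_comp,
    homologyRank_of_le (F.monotone (ha'.le.trans hab))]

lemma deadBefore_le_deadBy (a : ℝ) (b : WithTop ℝ) (hab : (a : WithTop ℝ) < b) :
    deadBefore F k a b ≤ deadBy F k a b hab := by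
  induction b with
  | top => exact le_top
  | coe b =>
    exact iSup_le fun c => deadAt_mono F k c.2.1 (WithTop.coe_lt_coe.1 hab).le (F.monotone (WithTop.coe_lt_coe.1 c.2.2).le)

/-- Subtracting `finrank_deadAt` at `c` from the same formula at `b` cancels the dimension of `H_k(F
a)`. Here `a'` and `c` play the roles of `a - ε` and `b - ε`; the additive form avoids truncated
subtraction. -/
lemma mult_persistenceDiagram_coe (hfin : ∀ r, (F r).faces.Finite) {a a' b c : ℝ}
    (hab : a < b) (ha' : a' < a) (h : ∀ r < a, F r ≤ F a') (hac : a ≤ c) (hcb : c < b)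
    (hc : ∀ r < b, F r ≤ F c) :
    (persistenceDiagram F k).mult ⟨(a, b), WithTop.coe_lt_coe.2 hab⟩ +
        homologyRank k (F a') (F c) + homologyRank k (F a) (F b) =
      homologyRank k (F a) (F c) + homologyRank k (F a') (F b) := by
  have := finite_homology (hfin a) k
  have h1 := finrank_quotient_submoduleOf
    (deadBefore_le_deadBy F k a b (WithTop.coe_lt_coe.2 hab))
  rw [deadBefore_eq_deadAt F k hac (WithTop.coe_lt_coe.2 hcb)
    fun r hr => hc r (WithTop.coe_lt_coe.1 hr)] at h1
  have h2 := finrank_deadAt F k (hfin a) hac ha' h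
  have h3 := finrank_deadAt F k (hfin a) hab.le ha' h
  have h4 : (persistenceDiagram F k).mult ⟨(a, b), WithTop.coe_lt_coe.2 hab⟩ =
      Module.finrank (ZMod 2) (deadBy F k a b (WithTop.coe_lt_coe.2 hab) ⧸
        (deadAt F k hac).submoduleOf (deadBy F k a b (WithTop.coe_lt_coe.2 hab))) := by
    rw [← deadBefore_eq_deadAt F k hac (WithTop.coe_lt_coe.2 hcb)
      fun r hr => hc r (WithTop.coe_lt_coe.1 hr)]
    rfl
  rw [← h4] at h1
  have h5 : deadBy F k a b (WithTop.coe_lt_coe.2 hab) = deadAt F k hab.le := rfl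
  rw [h5] at h1
  omega

lemma mult_persistenceDiagram_top (hfin : ∀ r, (F r).faces.Finite) {a a' c : ℝ}
    (ha' : a' < a) (h : ∀ r < a, F r ≤ F a') (hac : a ≤ c) (hc : ∀ r, F r ≤ F c) :
    (persistenceDiagram F k).mult ⟨(a, ⊤), WithTop.coe_lt_top a⟩ + homologyRank k (F a') (F c) =
      homologyRank k (F a) (F c) := by
  have := finite_homology (hfin a) k
  have h1 := finrank_quotient_submoduleOf (deadBefore_le_deadBy F k a ⊤ (WithTop.coe_lt_top a))
  rw [deadBefore_eq_deadAt F k hac (WithTop.coe_lt_top c) fun r _ => hc r] at h1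
  have h2 := finrank_deadAt F k (hfin a) hac ha' h
  have h4 : (persistenceDiagram F k).mult ⟨(a, ⊤), WithTop.coe_lt_top a⟩ =
      Module.finrank (ZMod 2) (deadBy F k a ⊤ (WithTop.coe_lt_top a) ⧸
        (deadAt F k hac).submoduleOf (deadBy F k a ⊤ (WithTop.coe_lt_top a))) := by
    rw [← deadBefore_eq_deadAt F k hac (WithTop.coe_lt_top c) fun r _ => hc r]
    rfl
  rw [← h4] at h1
  have h5 : deadBy F k a ⊤ (WithTop.coe_lt_top a) = ⊤ := rfl
  rw [h5, finrank_top] at h1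
  omega

end RankFormula

/-! ### A pairing of simplices shared by all coarsenings of a filtration. -/

section Pairing

variable {V : Type*}

/-- A class of `L₁` that comes from `L₀` once mapped to `L₂` still does so in `L₃`; comparing
dimensions of these two subspaces gives nonnegativity of multiplicities. -/
lemma homologyRank_add_le {L₀ L₁ L₂ L₃ : PreAbstractSimplicialComplex V} (h₁ : L₀ ≤ L₁)
    (h₂ : L₁ ≤ L₂) (h₃ : L₂ ≤ L₃) (hfin : L₁.faces.Finite) (k : ℕ) :
    homologyRank k L₀ L₂ + homologyRank k L₁ L₃ ≤
      homologyRank k L₁ L₂ + homologyRank k L₀ L₃ := by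
  have := finite_homology hfin k
  have e₁ := finrank_comap_range_comp (homologyMap h₁ k) (homologyMap h₂ k)
  have e₂ := finrank_comap_range_comp (homologyMap h₁ k) (homologyMap (h₂.trans h₃) k)
  have hle : (LinearMap.range (homologyMap h₂ k ∘ₗ homologyMap h₁ k)).comap (homologyMap h₂ k) ≤
      (LinearMap.range (homologyMap (h₂.trans h₃) k ∘ₗ homologyMap h₁ k)).comap
        (homologyMap (h₂.trans h₃) k) := by
    rw [← homologyMap_comp h₂ h₃]
    rintro x ⟨z, hz⟩
    exact ⟨z, congrArg (homologyMap h₃ k) hz⟩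
  have e₃ := Submodule.finrank_mono hle
  rw [homologyMap_comp] at e₁ e₂
  rw [homologyMap_comp, homologyMap_comp] at e₃
  rw [homologyRank_of_le (h₁.trans h₂), homologyRank_of_le (h₂.trans h₃), homologyRank_of_le h₂,
    homologyRank_of_le (h₁.trans (h₂.trans h₃))]
  omega

lemma homologyRank_mono_left {L₀ L₁ L₂ : PreAbstractSimplicialComplex V} (h₁ : L₀ ≤ L₁)
    (h₂ : L₁ ≤ L₂) (hfin : L₂.faces.Finite) (k : ℕ) :
    homologyRank k L₀ L₂ ≤ homologyRank k L₁ L₂ := by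
  have := finite_homology hfin k
  rw [homologyRank_of_le (h₁.trans h₂), homologyRank_of_le h₂, ← homologyMap_comp h₁ h₂]
  exact Submodule.finrank_mono (LinearMap.range_comp_le_range _ _)

/-- The mass that a function on the corners of the integer grid gives to a unit square. -/
def boxMass (ρ : ℕ → ℕ → ℤ) (i j : ℕ) : ℤ := ρ i (j - 1) - ρ (i - 1) (j - 1) - ρ i j + ρ (i - 1) j

lemma sum_boxMass (ρ : ℕ → ℕ → ℤ) {i₀ i₁ j₀ j₁ : ℕ} (hi : i₀ ≤ i₁) (hj : j₀ ≤ j₁) :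
    ∑ q ∈ Finset.Ioc i₀ i₁ ×ˢ Finset.Ioc j₀ j₁, boxMass ρ q.1 q.2 =
      ρ i₁ j₀ - ρ i₀ j₀ - ρ i₁ j₁ + ρ i₀ j₁ := by
  have key : ∀ (u : ℕ → ℤ) {m n : ℕ}, m ≤ n →
      ∑ i ∈ Finset.Ioc m n, (u i - u (i - 1)) = u n - u m := by
    intro u m n h
    induction n, h using Nat.le_induction with
    | base => simp
    | succ n h ih =>
      rw [← Finset.insert_Ioc_right_eq_Ioc_add_one h, Finset.sum_insert (by simp), ih]
      simp
  rw [Finset.sum_product]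
  have h1 : ∀ i, ∑ j ∈ Finset.Ioc j₀ j₁, boxMass ρ i j =
      (ρ i j₀ - ρ i j₁) - (ρ (i - 1) j₀ - ρ (i - 1) j₁) := fun i => by
    have := key (fun j => ρ (i - 1) j - ρ i j) hj
    rw [Finset.sum_congr rfl (g := fun j => (ρ (i - 1) j - ρ i j) -
      (ρ (i - 1) (j - 1) - ρ i (j - 1))) fun j _ => by unfold boxMass; ring, this]
    ring
  rw [Finset.sum_congr rfl fun i _ => h1 i, key (fun i => ρ i j₀ - ρ i j₁) hi]
  ring

lemma exists_threshold (p : ℕ → Prop) (hp : ∀ i j, i ≤ j → p j → p i) (m : ℕ) :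
    ∃ n ≤ m, ∀ i, 0 < i → i ≤ m → (p i ↔ i ≤ n) := by
  induction m with
  | zero => exact ⟨0, le_rfl, fun i h h' => by omega⟩
  | succ m ih =>
    obtain ⟨n, hn, h⟩ := ih
    by_cases hm : p (m + 1)
    · exact ⟨m + 1, le_rfl, fun i _ hi => ⟨fun _ => hi, fun _ => hp _ _ hi hm⟩⟩
    · refine ⟨n, hn.trans m.le_succ, fun i h0 hi => ?_⟩
      rcases Nat.lt_or_ge m i with h1 | h1
      · obtain rfl : i = m + 1 := by omega
        exact ⟨fun h => absurd h hm, fun h => by omega⟩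
      · exact h i h0 h1

/-- The ranks of the maps `H_k(L i) → H_k(L j)`, where the homology is `0` beyond time `m`. -/
def levelRank (L : ℕ → PreAbstractSimplicialComplex V) (k m i j : ℕ) : ℤ :=
  if j ≤ m then homologyRank k (L i) (L j) else 0

/-- The times `y 0, …, y m`, followed by `∞`. -/
def withInfinity (m : ℕ) (y : ℕ → ℝ) (j : ℕ) : WithTop ℝ := if j ≤ m then (y j : WithTop ℝ) else ⊤

lemma boxMass_levelRank_nonneg {L : ℕ → PreAbstractSimplicialComplex V} (hL : Monotone L)
    (hfin : ∀ n, (L n).faces.Finite) (k : ℕ) {m i j : ℕ} (hij : i < j) (hj : j ≤ m + 1) :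
    0 ≤ boxMass (levelRank L k m) i j := by
  unfold boxMass levelRank
  rw [if_pos (show j - 1 ≤ m by omega), if_pos (show j - 1 ≤ m by omega)]
  split_ifs with h
  · have := homologyRank_add_le (hL (show i - 1 ≤ i by omega)) (hL (show i ≤ j - 1 by omega))
      (hL (show j - 1 ≤ j by omega)) (hfin i) k
    omega
  · have := homologyRank_mono_left (hL (show i - 1 ≤ i by omega)) (hL (show i ≤ j - 1 by omega))
      (hfin (j - 1)) k
    omega

/-- The levels `y` may coincide, so those equal to `a` and those equal to `b` form blocks of
consecutive indices. The masses over the product of the blocks telescope to the rank formula for the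
multiplicity. -/
lemma mult_eq_sum_boxMass {L : ℕ → PreAbstractSimplicialComplex V}
    (hfin : ∀ n, (L n).faces.Finite) (k : ℕ) {m : ℕ} {y : ℕ → ℝ} (hy : Monotone y)
    (F : ℝ →o PreAbstractSimplicialComplex V)
    (hF : ∀ r, ∀ n ≤ m, (∀ i, 0 < i → i ≤ m → (y i ≤ r ↔ i ≤ n)) → F r = L n) (p : UpperPlane) :
    ((persistenceDiagram F k).mult p : ℤ) = ∑ q ∈ Finset.Ioc 0 m ×ˢ Finset.Ioc 0 (m + 1),
      if (y q.1, withInfinity m y q.2) = p.1 then boxMass (levelRank L k m) q.1 q.2 else 0 := by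
  obtain ⟨⟨a, b⟩, hab⟩ := p
  have hFfin : ∀ r, (F r).faces.Finite := fun r => by
    obtain ⟨n, hn, h⟩ := exists_threshold (fun i => y i ≤ r) (fun i j h h' => (hy h).trans h') m
    rw [hF r n hn h]
    exact hfin n
  have hlt : ∀ r : WithTop ℝ, ∃ n ≤ m, ∀ i, 0 < i → i ≤ m → ((y i : WithTop ℝ) < r ↔ i ≤ n) :=
    fun r => exists_threshold (fun i => (y i : WithTop ℝ) < r)
      (fun i j h h' => (WithTop.coe_le_coe.2 (hy h)).trans_lt h') m
  have hle : ∀ r : ℝ, ∃ n ≤ m, ∀ i, 0 < i → i ≤ m → (y i ≤ r ↔ i ≤ n) :=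
    fun r => exists_threshold (fun i => y i ≤ r) (fun i j h h' => (hy h).trans h') m
  have hmem : ∀ {r r' : ℝ}, (∀ i, 0 < i → i ≤ m → y i ≤ r → y i ≤ r') → F r ≤ F r' := by
    intro r r' h
    -- Since `r ≤ r'` is not assumed, compare through `max r r'`, which has the same levels below it
    -- as `r'`.
    obtain ⟨n, hn, h1⟩ := hle r
    obtain ⟨n', hn', h1'⟩ := hle (max r r')
    obtain ⟨n'', hn'', h1''⟩ := hle r'
    have e : F (max r r') = F r' := by
      rw [hF r' n'' hn'' h1'']
      refine hF _ n'' hn'' fun i hi him => ?_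
      rw [← h1'' i hi him, le_max_iff]
      exact ⟨fun h' => h'.elim (h i hi him) id, Or.inr⟩
    rw [← e]
    exact F.monotone (le_max_left _ _)
  obtain ⟨i₀, hi₀m, hi₀⟩ := hlt a
  obtain ⟨i₁, hi₁m, hi₁⟩ := hle a
  simp only [WithTop.coe_lt_coe] at hi₀
  have hi : i₀ ≤ i₁ := by
    by_contra hcon
    have h1 := (hi₀ i₀ (by omega) hi₀m).2 le_rfl
    have h2 := (hi₁ i₀ (by omega) hi₀m).1 h1.le
    omega
  obtain ⟨a', ha', hya'⟩ : ∃ a' < a, ∀ i, 0 < i → i ≤ m → y i < a → y i ≤ a' := by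
    classical
    -- The last level before `a`, with `a - 1` ensuring that the set is nonempty.
    let s : Finset ℝ := insert (a - 1) (((Finset.Ioc 0 m).filter fun i => y i < a).image y)
    refine ⟨s.max' (Finset.insert_nonempty _ _), ?_, fun i h1 h2 h3 => s.le_max' _ ?_⟩
    · rw [Finset.max'_lt_iff]
      simp only [s, Finset.mem_insert, Finset.mem_image, Finset.mem_filter]
      rintro x (rfl | ⟨i, hi, rfl⟩)
      · linarith
      · exact hi.2
    · simp only [s, Finset.mem_insert, Finset.mem_image, Finset.mem_filter, Finset.mem_Ioc]
      exact Or.inr ⟨i, ⟨⟨h1, h2⟩, h3⟩, rfl⟩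
  have hFa' : F a' = L i₀ := hF a' i₀ hi₀m fun i h1 h2 => by
    rw [← hi₀ i h1 h2]
    exact ⟨fun h => h.trans_lt ha', hya' i h1 h2⟩
  have hFa : F a = L i₁ := hF a i₁ hi₁m hi₁
  have hFlt : ∀ r < a, F r ≤ F a' := fun r hr =>
    hmem fun i h1 h2 h3 => hya' i h1 h2 (h3.trans_lt hr)
  obtain ⟨c, hac, hcb, hc⟩ : ∃ c : ℝ, a ≤ c ∧ (c : WithTop ℝ) < b ∧
      ∀ i, 0 < i → i ≤ m → (y i : WithTop ℝ) < b → y i ≤ c := by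
    classical
    let s : Finset ℝ := insert a (((Finset.Ioc 0 m).filter fun i => (y i : WithTop ℝ) < b).image y)
    have hs : s.Nonempty := Finset.insert_nonempty _ _
    refine ⟨s.max' hs, s.le_max' _ (Finset.mem_insert_self _ _), ?_,
      fun i h1 h2 h3 => s.le_max' _ ?_⟩
    · have h1 := s.max'_mem hs
      generalize s.max' hs = x at h1
      simp only [s, Finset.mem_insert, Finset.mem_image, Finset.mem_filter] at h1
      obtain rfl | ⟨i, hi, rfl⟩ := h1
      · exact hab
      · exact hi.2
    · simp only [s, Finset.mem_insert, Finset.mem_image, Finset.mem_filter, Finset.mem_Ioc]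
      exact Or.inr ⟨i, ⟨⟨h1, h2⟩, h3⟩, rfl⟩
  obtain ⟨j₀, hj₀m, hj₀⟩ := hlt b
  have hFc : F c = L j₀ := hF c j₀ hj₀m fun i h1 h2 => by
    rw [← hj₀ i h1 h2]
    exact ⟨fun h => (WithTop.coe_le_coe.2 h).trans_lt hcb, hc i h1 h2⟩
  have hFltb : ∀ r : ℝ, (r : WithTop ℝ) < b → F r ≤ F c := fun r hr =>
    hmem fun i h1 h2 h3 => hc i h1 h2 ((WithTop.coe_le_coe.2 h3).trans_lt hr)
  have hsum : ∀ j₁, j₀ ≤ j₁ → j₁ ≤ m + 1 →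
      (∀ j, 0 < j → j ≤ m + 1 → (withInfinity m y j = b ↔ j₀ < j ∧ j ≤ j₁)) →
      (∑ q ∈ Finset.Ioc 0 m ×ˢ Finset.Ioc 0 (m + 1),
        if (y q.1, withInfinity m y q.2) = (a, b) then boxMass (levelRank L k m) q.1 q.2 else 0) =
      levelRank L k m i₁ j₀ - levelRank L k m i₀ j₀ - levelRank L k m i₁ j₁
        + levelRank L k m i₀ j₁ := by
    intro j₁ hj hj₁m h
    rw [← sum_boxMass _ hi hj, ← Finset.sum_filter]
    refine Finset.sum_congr (Finset.ext fun q => ?_) fun _ _ => rfl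
    simp only [Finset.mem_filter, Finset.mem_product, Finset.mem_Ioc, Prod.mk.injEq]
    have e1 : 0 < q.1 → q.1 ≤ m → (y q.1 = a ↔ i₀ < q.1 ∧ q.1 ≤ i₁) := fun h1 h2 => by
      rw [← hi₁ _ h1 h2, ← not_le, ← hi₀ _ h1 h2, not_lt, and_comm, ← le_antisymm_iff]
    constructor
    · rintro ⟨⟨⟨h1, h2⟩, h3, h4⟩, h5, h6⟩
      exact ⟨(e1 h1 h2).1 h5, (h _ h3 h4).1 h6⟩
    · rintro ⟨⟨h1, h2⟩, h3, h4⟩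
      refine ⟨⟨⟨by omega, by omega⟩, by omega, by omega⟩, (e1 ?_ ?_).2 ⟨h1, h2⟩,
        (h _ ?_ ?_).2 ⟨h3, h4⟩⟩ <;> omega
  induction b with
  | top =>
    -- All finite levels lie below `∞`, so the block for `b = ∞` is the single index `m + 1`.
    obtain rfl : j₀ = m := by
      by_contra hcon
      have := (hj₀ m (by omega) le_rfl).1 (WithTop.coe_lt_top _)
      omega
    rw [hsum (j₀ + 1) (by omega) le_rfl]
    · have := mult_persistenceDiagram_top F k hFfin ha' hFlt hac
        fun r => hFltb r (WithTop.coe_lt_top r)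
      rw [hFa, hFa', hFc] at this
      simp only [levelRank, le_refl, if_true, if_neg (show ¬ j₀ + 1 ≤ j₀ by omega)]
      omega
    · intro j h1 h2
      unfold withInfinity
      split_ifs with h3
      · exact ⟨fun h => absurd h (WithTop.coe_ne_top), fun h => by omega⟩
      · exact ⟨fun _ => by omega, fun _ => rfl⟩
  | coe b =>
    obtain ⟨j₁, hj₁m, hj₁⟩ := hle b
    simp only [WithTop.coe_lt_coe] at hj₀
    have hj : j₀ ≤ j₁ := by
      by_contra hcon
      have h1 := (hj₀ j₀ (by omega) hj₀m).2 le_rfl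
      have h2 := (hj₁ j₀ (by omega) hj₀m).1 h1.le
      omega
    rw [hsum j₁ hj (by omega)]
    · have := mult_persistenceDiagram_coe F k hFfin (WithTop.coe_lt_coe.1 hab) ha' hFlt hac
        (WithTop.coe_lt_coe.1 hcb) fun r hr => hFltb r (WithTop.coe_lt_coe.2 hr)
      rw [hFa, hFa', hFc, hF b j₁ hj₁m hj₁] at this
      change (persistenceDiagram F k).mult ⟨(a, b), hab⟩ + _ + _ = _ at this
      simp only [levelRank, if_pos hj₀m, if_pos hj₁m]
      omega
    · intro j h1 h2
      unfold withInfinity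
      split_ifs with h3
      · rw [WithTop.coe_eq_coe, ← hj₁ _ h1 h3, ← not_le, ← hj₀ _ h1 h3, not_lt, and_comm,
          ← le_antisymm_iff]
      · exact ⟨fun h => absurd h.symm (WithTop.coe_ne_top), fun h => by omega⟩

/-- `F` is the filtration of the complex with faces `S` by the sublevel sets of `f`. -/
def IsSublevelFiltration (S : Set (Finset V)) (f : Finset V → ℝ)
    (F : ℝ →o PreAbstractSimplicialComplex V) : Prop :=
  ∀ r s, s ∈ (F r).faces ↔ s ∈ S ∧ f s ≤ r

/-- On `S`, equal values of `h` force equal values of `f`, so `f` factors through `h`; the factor is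
monotone on the image and bounded, hence extends to `ℕ`. -/
lemma exists_monotone_comp_eq {α : Type*} {S : Set α} (hS : S.Finite) (h : α → ℕ) (f : α → ℝ)
    (hf : ∀ s ∈ S, ∀ t ∈ S, h s ≤ h t → f s ≤ f t) :
    ∃ y : ℕ → ℝ, Monotone y ∧ ∀ s ∈ S, y (h s) = f s := by
  classical
  rcases S.eq_empty_or_nonempty with rfl | ⟨s₀, hs₀⟩
  · exact ⟨fun _ => 0, monotone_const, fun s hs => absurd hs (Set.notMem_empty s)⟩
  have : Nonempty α := ⟨s₀⟩
  let g : ℕ → ℝ := f ∘ Function.invFunOn h S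
  have hg : MonotoneOn g (h '' S) := by
    rintro _ ⟨s, hs, rfl⟩ _ ⟨t, ht, rfl⟩ hst
    have e : ∀ {s}, s ∈ S → h (Function.invFunOn h S (h s)) = h s ∧
        Function.invFunOn h S (h s) ∈ S := fun {s} hs =>
      ⟨Function.invFunOn_eq ⟨s, hs, rfl⟩, Function.invFunOn_mem ⟨s, hs, rfl⟩⟩
    exact hf _ (e hs).2 _ (e ht).2 (by rw [(e hs).1, (e ht).1]; exact hst)
  have hfin : (g '' (h '' S)).Finite := (hS.image h).image g
  obtain ⟨y, hy, hyg⟩ := hg.exists_monotone_extension hfin.bddBelow hfin.bddAbove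
  refine ⟨y, hy, fun s hs => ?_⟩
  rw [← hyg ⟨s, hs, rfl⟩]
  have e1 : h (Function.invFunOn h S (h s)) = h s := Function.invFunOn_eq ⟨s, hs, rfl⟩
  have e2 : Function.invFunOn h S (h s) ∈ S := Function.invFunOn_mem ⟨s, hs, rfl⟩
  exact le_antisymm (hf _ e2 _ hs e1.le) (hf _ hs _ e2 e1.ge)

lemma card_sigma_fin_subtype {ι β : Type*} (B : Finset ι) (ν : ι → ℕ) (P : ι → β) (p : β)
    [DecidableEq β] :
    Nat.card {x : (Σ q : B, Fin (ν q)) // P x.1 = p} = ∑ q ∈ B, if P q = p then ν q else 0 := by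
  rw [Nat.card_eq_fintype_card, Fintype.card_subtype, Finset.card_eq_sum_ones, Finset.sum_filter,
    Fintype.sum_sigma, ← Finset.sum_coe_sort B]
  refine Finset.sum_congr rfl fun q _ => ?_
  by_cases hq : P q = p <;> simp [hq]

/-- The pairing of the simplices of a filtration: the persistence diagrams of all filtrations `f`
that are coarser than a given filtration `f₀` consist of the points `(f σ, f τ)`, where `(σ, τ)`
runs through pairs of simplices that do not depend on `f` (`τ` may be missing). -/
theorem exists_pairing {S : Set (Finset V)} (hS : S.Finite) {f₀ : Finset V → ℝ}
    {F₀ : ℝ →o PreAbstractSimplicialComplex V} (hF₀ : IsSublevelFiltration S f₀ F₀) (k : ℕ) :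
    ∃ (I : Type) (_ : Fintype I) (σ : I → Finset V) (τ : I → WithTop (Finset V)),
      (∀ x, σ x ∈ S) ∧ (∀ x (t : Finset V), τ x = t → t ∈ S ∧ f₀ (σ x) ≤ f₀ t) ∧
      ∀ (f : Finset V → ℝ) (F : ℝ →o PreAbstractSimplicialComplex V),
        IsSublevelFiltration S f F → (∀ s ∈ S, ∀ t ∈ S, f₀ s ≤ f₀ t → f s ≤ f t) →
        ∀ p : UpperPlane, (persistenceDiagram F k).mult p =
          Nat.card {x : I // (f (σ x), (τ x).map f) = p.1} := by
  classical
  let T : Finset (Finset V) := hS.toFinset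
  let m := T.card
  -- Rank in the order of `f₀`: ties share a rank, and some values between `1` and `m` may be
  -- skipped.
  let h : Finset V → ℕ := fun s => (T.filter fun t => f₀ t ≤ f₀ s).card
  have hpos : ∀ s ∈ S, 0 < h s := fun s hs =>
    Finset.card_pos.2 ⟨s, Finset.mem_filter.2 ⟨hS.mem_toFinset.2 hs, le_rfl⟩⟩
  have hm : ∀ s, h s ≤ m := fun s => Finset.card_filter_le _ _
  have hmono : ∀ s t, f₀ s ≤ f₀ t → h s ≤ h t := fun s t hst =>
    Finset.card_le_card fun u hu => by
      rw [Finset.mem_filter] at hu ⊢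
      exact ⟨hu.1, hu.2.trans hst⟩
  have hmono' : ∀ s ∈ S, ∀ t ∈ S, h s ≤ h t → f₀ s ≤ f₀ t := by
    intro s hs t ht hst
    by_contra! hcon
    refine hst.not_gt (Finset.card_lt_card ?_)
    rw [Finset.ssubset_iff_of_subset fun u hu => by
      rw [Finset.mem_filter] at hu ⊢
      exact ⟨hu.1, hu.2.trans hcon.le⟩]
    exact ⟨s, Finset.mem_filter.2 ⟨hS.mem_toFinset.2 hs, le_rfl⟩,
      fun hu => (Finset.mem_filter.1 hu).2.not_gt hcon⟩
  let L : ℕ → PreAbstractSimplicialComplex V := fun n =>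
    { faces := {s | s ∈ S ∧ h s ≤ n}
      isRelLowerSet_faces := fun {s} hs =>
        ⟨((F₀ (f₀ s)).isRelLowerSet_faces ((hF₀ _ _).2 ⟨hs.1, le_rfl⟩)).1, fun t hts ht => by
          have := (hF₀ _ _).1 (((F₀ (f₀ s)).isRelLowerSet_faces
            ((hF₀ _ _).2 ⟨hs.1, le_rfl⟩)).2 hts ht)
          exact ⟨this.1, (hmono _ _ this.2).trans hs.2⟩⟩ }
  have hL : Monotone L := fun i j hij s hs => ⟨hs.1, hs.2.trans hij⟩
  have hLfin : ∀ n, (L n).faces.Finite := fun n => hS.subset fun s hs => hs.1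
  -- Nothing enters at a skipped rank, so boxes there have mass zero, and every finite index of a
  -- box of nonzero mass is the rank of a simplex.
  have hLeq : ∀ i, 0 < i → (¬ ∃ s ∈ S, h s = i) → L (i - 1) = L i := by
    intro i hi hne
    refine le_antisymm (hL (by omega)) fun s hs => ⟨hs.1, ?_⟩
    have h1 : h s ≠ i := fun h' => hne ⟨s, hs.1, h'⟩
    have h2 : h s ≤ i := hs.2
    omega
  let μ : ℕ → ℕ → ℤ := boxMass (levelRank L k m)
  have hμ₁ : ∀ i j, 0 < i → μ i j ≠ 0 → ∃ s ∈ S, h s = i := by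
    intro i j hi hne
    by_contra hcon
    refine hne ?_
    simp only [μ, boxMass, levelRank, hLeq i hi hcon]
    ring
  have hμ₂ : ∀ i j, 0 < j → j ≤ m → μ i j ≠ 0 → ∃ s ∈ S, h s = j := by
    intro i j hj hjm hne
    by_contra hcon
    refine hne ?_
    simp only [μ, boxMass, levelRank, hLeq j hj hcon, if_pos hjm, if_pos (show j - 1 ≤ m by omega)]
    ring
  -- Boxes with `q.1 ≥ q.2` can be dropped: by monotonicity of `y`, those with finite death never
  -- give a point strictly above the diagonal, and index `m + 1` always exceeds `q.1`.
  let ν : ℕ × ℕ → ℕ := fun q => if q.1 < q.2 then (μ q.1 q.2).toNat else 0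
  let B : Finset (ℕ × ℕ) := Finset.Ioc 0 m ×ˢ Finset.Ioc 0 (m + 1)
  let rep : ℕ → Finset V := fun i => if hi : ∃ s ∈ S, h s = i then hi.choose else ∅
  have hrep : ∀ i, (∃ s ∈ S, h s = i) → rep i ∈ S ∧ h (rep i) = i := fun i hi => by
    simp only [rep, dif_pos hi]
    exact hi.choose_spec
  have hx : ∀ x : (Σ q : B, Fin (ν q)), x.1.1.1 < x.1.1.2 ∧ (∃ s ∈ S, h s = x.1.1.1) ∧
      (x.1.1.2 ≤ m → ∃ s ∈ S, h s = x.1.1.2) := by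
    rintro ⟨⟨q, hq⟩, n⟩
    have hn : ν q ≠ 0 := fun h0 => (Fin.cast h0 n).elim0
    simp only [B, Finset.mem_product, Finset.mem_Ioc] at hq
    have hlt : q.1 < q.2 := by
      by_contra hcon
      exact hn (if_neg hcon)
    have hne : μ q.1 q.2 ≠ 0 := fun h0 => hn (by simp only [ν, if_pos hlt, h0, Int.toNat_zero])
    exact ⟨hlt, hμ₁ _ _ hq.1.1 hne, fun hm' => hμ₂ _ _ hq.2.1 hm' hne⟩
  refine ⟨Σ q : B, Fin (ν q), inferInstance, fun x => rep x.1.1.1,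
    fun x => if x.1.1.2 ≤ m then (rep x.1.1.2 : Finset V) else ⊤,
    fun x => (hrep _ (hx x).2.1).1, fun x t ht => ?_, fun f F hF hf p => ?_⟩
  · dsimp only at ht ⊢
    split_ifs at ht with h1
    · rw [WithTop.coe_eq_coe] at ht
      subst ht
      obtain ⟨h2, h3⟩ := hrep _ ((hx x).2.2 h1)
      obtain ⟨h4, h5⟩ := hrep _ (hx x).2.1
      refine ⟨h2, hmono' _ h4 _ h2 ?_⟩
      rw [h3, h5]
      exact (hx x).1.le
    · exact absurd ht.symm WithTop.coe_ne_top
  · obtain ⟨y, hy, hyf⟩ := exists_monotone_comp_eq hS h f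
      fun s hs t ht hst => hf s hs t ht (hmono' s hs t ht hst)
    have hmult := mult_eq_sum_boxMass hLfin k (m := m) hy F (fun r n hn hrn => by
      refine PreAbstractSimplicialComplex.ext (Set.ext fun s => (hF r s).trans ?_)
      refine and_congr_right fun hs => ?_
      rw [← hyf s hs, hrn _ (hpos s hs) (hm s)]) p
    have hpt : ∀ x : (Σ q : B, Fin (ν q)), (f (rep x.1.1.1),
        WithTop.map f (if x.1.1.2 ≤ m then (rep x.1.1.2 : Finset V) else ⊤)) =
        (y x.1.1.1, withInfinity m y x.1.1.2) := by
      intro x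
      have e : ∀ i, (∃ s ∈ S, h s = i) → f (rep i) = y i := fun i hi => by
        rw [← hyf _ (hrep i hi).1, (hrep i hi).2]
      rw [e _ (hx x).2.1]
      unfold withInfinity
      split_ifs with h1
      · rw [WithTop.map_coe, e _ ((hx x).2.2 h1)]
      · rfl
    simp only [hpt]
    rw [card_sigma_fin_subtype B ν (fun q => (y q.1, withInfinity m y q.2))]
    rw [← Int.natCast_inj, hmult, Nat.cast_sum]
    refine Finset.sum_congr rfl fun q hq => ?_
    split_ifs with h1
    · have hp := p.2
      rw [← h1] at hp
      simp only [B, Finset.mem_product, Finset.mem_Ioc] at hq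
      have hlt : q.1 < q.2 := by
        by_contra hcon
        unfold withInfinity at hp
        rw [if_pos (by omega)] at hp
        exact (WithTop.coe_lt_coe.1 hp).not_ge (hy (by omega))
      simp only [ν, if_pos hlt]
      exact (Int.toNat_of_nonneg (boxMass_levelRank_nonneg hL hLfin k hlt (by omega))).symm
    · rfl

end Pairing

/-! ### Distance between diagrams given by indexed families of points. -/

namespace PersistenceDiagram

/-- The off-diagonal points of `X` are the off-diagonal values of the family `P`. -/
def Represents (X : PersistenceDiagram) {I : Type*} (P : I → ℝ × WithTop ℝ) : Prop :=
  ∀ p : UpperPlane, X.mult p = Nat.card {x // P x = p.1}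

variable {I : Type*} {X Y : PersistenceDiagram} {P Q : I → ℝ × WithTop ℝ}

lemma Represents.exists_offDiagonal_equiv [Finite I] (h : X.Represents P) :
    ∃ e : X.OffDiagonal ≃ {x : I // ((P x).1 : WithTop ℝ) < (P x).2},
      ∀ z, P (e z).1 = z.1.1 := by
  let e₁ : X.OffDiagonal ≃ Σ p : UpperPlane, {x // P x = p.1} :=
    Equiv.sigmaCongrRight fun p => (finCongr (h p)).trans (Finite.equivFin _).symm
  let e₂ : (Σ p : UpperPlane, {x // P x = p.1}) ≃ {x : I // ((P x).1 : WithTop ℝ) < (P x).2} :=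
    { toFun := fun z => ⟨z.2.1, by rw [z.2.2]; exact z.1.2⟩
      invFun := fun x => ⟨⟨P x.1, x.2⟩, ⟨x.1, rfl⟩⟩
      left_inv := by
        rintro ⟨⟨p, hp⟩, ⟨x, hx⟩⟩
        obtain rfl : P x = p := hx
        rfl
      right_inv := fun x => rfl }
  exact ⟨e₁.trans e₂, fun z => (e₁ z).2.2⟩

lemma Represents.card_offDiagonal [Finite I] (h : X.Represents P) :
    ENat.card X.OffDiagonal = Nat.card {x : I // ((P x).1 : WithTop ℝ) < (P x).2} := by
  obtain ⟨e, -⟩ := h.exists_offDiagonal_equiv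
  rw [ENat.card_congr e, ENat.card_eq_coe_natCard]

/-- Countably many copies of the diagonal absorb countably many further diagonal points. -/
lemma exists_absorbing_equiv {J : Type*} [Countable J] (q : J → ℝ) :
    ∃ e : J ⊕ (ℝ × ℕ) ≃ ℝ × ℕ, ∀ z, (e z).1 = Sum.elim q Prod.fst z := by
  let g : J ⊕ (ℝ × ℕ) → ℝ := Sum.elim q Prod.fst
  -- Each fibre over `t` is countably infinite, so the fibres can be identified with `ℕ` one at a
  -- time.
  have hne : ∀ t, Nonempty ({z // g z = t} ≃ ℕ) := by
    intro t
    have hc : Countable {z // g z = t} := by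
      let i : {z // g z = t} → J ⊕ ℕ := fun z => Sum.map id Prod.snd z.1
      refine Function.Injective.countable (f := i) ?_
      rintro ⟨z | ⟨r, n⟩, hz⟩ ⟨z' | ⟨r', n'⟩, hz'⟩ h
      · simpa [i] using h
      · simp [i] at h
      · simp [i] at h
      · simp only [g, Sum.elim_inr] at hz hz'
        simp only [i, Sum.map_inr, Sum.inr.injEq] at h
        subst hz hz' h
        rfl
    have hi : Infinite {z // g z = t} :=
      Infinite.of_injective (fun n : ℕ => ⟨Sum.inr (t, n), rfl⟩) fun n n' h => by
        simpa using congrArg Subtype.val h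
    obtain ⟨hd⟩ := nonempty_denumerable {z // g z = t}
    exact ⟨Denumerable.eqv _⟩
  refine ⟨(Equiv.sigmaFiberEquiv g).symm.trans
    ((Equiv.sigmaCongrRight fun t => (hne t).some).trans (Equiv.sigmaEquivProd ℝ ℕ)),
    fun z => rfl⟩

/-- The members of the family lying on the diagonal are absorbed by its infinitely many copies. -/
lemma Represents.exists_points_equiv [Finite I] (h : X.Represents P)
    (hP : ∀ x, ((P x).1 : WithTop ℝ) ≤ (P x).2) :
    ∃ e : I ⊕ (ℝ × ℕ) ≃ X.Points,
      ∀ z, pos (e z) = Sum.elim P (fun t => (t.1, (t.1 : WithTop ℝ))) z := by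
  classical
  obtain ⟨e₁, he₁⟩ := h.exists_offDiagonal_equiv
  let p : I → Prop := fun x => ((P x).1 : WithTop ℝ) < (P x).2
  obtain ⟨e₂, he₂⟩ := exists_absorbing_equiv (fun x : {x // ¬ p x} => (P x.1).1)
  let e₃ : I ⊕ (ℝ × ℕ) ≃ {x // p x} ⊕ ({x // ¬ p x} ⊕ (ℝ × ℕ)) :=
    ((Equiv.sumCompl p).symm.sumCongr (Equiv.refl _)).trans (Equiv.sumAssoc _ _ _)
  let e : I ⊕ (ℝ × ℕ) ≃ X.Points := e₃.trans (e₁.symm.sumCongr e₂)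
  refine ⟨e, fun z => ?_⟩
  obtain ⟨w, rfl⟩ := e₃.symm.surjective z
  have hw : e (e₃.symm w) = Sum.map e₁.symm e₂ w := by simp [e]
  rw [hw]
  rcases w with x | x | t
  · have := he₁ (e₁.symm x)
    rw [Equiv.apply_symm_apply] at this
    simp [e₃, pos, this]
  · have := he₂ (Sum.inl x)
    have hx : ((P x.1).1 : WithTop ℝ) = (P x.1).2 := (hP x.1).eq_or_lt.resolve_right x.2
    simp only [Sum.map_inr, pos, this]
    simp [e₃, hx]
  · have := he₂ (Sum.inr t)
    simp only [Sum.map_inr, pos, this]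
    simp [e₃]

lemma edist_le_sum [Fintype I] (hX : X.Represents P) (hY : Y.Represents Q)
    (hP : ∀ x, ((P x).1 : WithTop ℝ) ≤ (P x).2) (hQ : ∀ x, ((Q x).1 : WithTop ℝ) ≤ (Q x).2) :
    edist X Y ≤ ∑ x, l1Dist (P x) (Q x) := by
  obtain ⟨e, he⟩ := hX.exists_points_equiv hP
  obtain ⟨e', he'⟩ := hY.exists_points_equiv hQ
  rw [edist_def]
  refine (iInf_le _ (e.symm.trans e')).trans (le_of_eq ?_)
  rw [← e.tsum_eq, tsum_eq_sum (s := Finset.univ.map Function.Embedding.inl)]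
  · rw [Finset.sum_map]
    exact Finset.sum_congr rfl fun x _ => by simp [he, he']
  · rintro (x | t) hz
    · simp at hz
    · simp [he, he', l1Dist_self]

lemma Represents.restrict (h : X.Represents P) (p : I → Prop)
    (hp : ∀ x, ((P x).1 : WithTop ℝ) < (P x).2 → p x) :
    X.Represents fun x : {x // p x} => P x.1 := fun q => by
  rw [h q]
  refine Nat.card_congr (Equiv.symm (Equiv.subtypeSubtypeEquivSubtype (p := p)
    (q := fun x => P x = q.1) fun {x} hx => hp x ?_))
  rw [hx]
  exact q.2

/-- Indices where `P` is on the diagonal are discarded; by `hPQ` this loses no off-diagonal point of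
`Y`, and at most `N` indices remain. -/
lemma edist_le_mul [Finite I] (hX : X.Represents P) (hY : Y.Represents Q)
    (hP : ∀ x, ((P x).1 : WithTop ℝ) ≤ (P x).2) (hQ : ∀ x, ((Q x).1 : WithTop ℝ) ≤ (Q x).2)
    (hPQ : ∀ x, ((Q x).1 : WithTop ℝ) < (Q x).2 → ((P x).1 : WithTop ℝ) < (P x).2)
    {C : ℝ≥0∞} (hC : ∀ x, l1Dist (P x) (Q x) ≤ C) {N : ℕ} (hN : ENat.card X.OffDiagonal ≤ N) :
    edist X Y ≤ N * C := by
  have := Fintype.ofFinite {x : I // ((P x).1 : WithTop ℝ) < (P x).2}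
  refine (edist_le_sum (hX.restrict _ fun x hx => hx) (hY.restrict _ hPQ)
    (fun x => hP x.1) (fun x => hQ x.1)).trans ?_
  refine (Finset.sum_le_card_nsmul _ _ C fun x _ => hC x.1).trans ?_
  rw [nsmul_eq_mul]
  gcongr
  rw [hX.card_offDiagonal, Nat.card_eq_fintype_card] at hN
  exact_mod_cast hN

end PersistenceDiagram

open Filter Topology PersistenceDiagram

/-! ### Heights of simplices and the local estimate. -/

section HeightFunction

variable {d : ℕ}

/-- The maximal height in direction `v` of a vertex of the simplex `s`. -/
def simplexHeight (v : EuclideanSpace ℝ (Fin d)) (s : Finset (EuclideanSpace ℝ (Fin d))) : ℝ :=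
  if h : s.Nonempty then s.sup' h fun x => inner ℝ x v else 0

lemma simplexHeight_le_iff {s : Finset (EuclideanSpace ℝ (Fin d))} (hs : s.Nonempty)
    (v : EuclideanSpace ℝ (Fin d)) (r : ℝ) :
    simplexHeight v s ≤ r ↔ ∀ x ∈ s, inner ℝ x v ≤ r := by
  rw [simplexHeight, dif_pos hs, Finset.sup'_le_iff]

lemma continuous_simplexHeight (s : Finset (EuclideanSpace ℝ (Fin d))) :
    Continuous fun v => simplexHeight v s := by
  unfold simplexHeight
  split_ifs with h
  · exact Continuous.finset_sup'_apply h fun x _ => by fun_prop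
  · exact continuous_const

lemma simplexHeight_smul {s : Finset (EuclideanSpace ℝ (Fin d))} (hs : s.Nonempty)
    (v : EuclideanSpace ℝ (Fin d)) {c : ℝ} (hc : 0 < c) :
    simplexHeight (c • v) s = c * simplexHeight v s := by
  refine eq_of_forall_ge_iff fun r => ?_
  rw [← le_div_iff₀' hc, simplexHeight_le_iff hs, simplexHeight_le_iff hs]
  simp only [inner_smul_right, le_div_iff₀' hc]

lemma simplexHeight_le_add {s : Finset (EuclideanSpace ℝ (Fin d))} (hs : s.Nonempty) {K : ℝ}
    (hK : ∀ x ∈ s, ‖x‖ ≤ K) (v w : EuclideanSpace ℝ (Fin d)) :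
    simplexHeight v s ≤ simplexHeight w s + K * ‖v - w‖ := by
  rw [simplexHeight_le_iff hs]
  intro x hx
  have h1 := (simplexHeight_le_iff hs w _).1 le_rfl x hx
  have h2 : inner ℝ x v = inner ℝ x w + inner ℝ x (v - w) := by
    rw [← inner_add_right, add_sub_cancel]
  have h3 : inner ℝ x (v - w) ≤ K * ‖v - w‖ :=
    (real_inner_le_norm _ _).trans (mul_le_mul_of_nonneg_right (hK x hx) (norm_nonneg _))
  linarith

lemma edist_simplexHeight_le {s : Finset (EuclideanSpace ℝ (Fin d))} (hs : s.Nonempty) {K : ℝ≥0}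
    (hK : ∀ x ∈ s, ‖x‖ ≤ K) (v w : EuclideanSpace ℝ (Fin d)) :
    edist (simplexHeight v s) (simplexHeight w s) ≤ K * edist v w := by
  have h : dist (simplexHeight v s) (simplexHeight w s) ≤ K * dist v w := by
    rw [Real.dist_eq, abs_le, dist_eq_norm]
    have h1 := simplexHeight_le_add hs hK v w
    have h2 := simplexHeight_le_add hs hK w v
    rw [norm_sub_rev] at h2
    constructor <;> linarith
  rw [edist_nndist, edist_nndist, ← ENNReal.coe_mul, ENNReal.coe_le_coe]
  exact h

variable (M : Geometry.SimplicialComplex ℝ (EuclideanSpace ℝ (Fin d)))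

lemma isSublevelFiltration_heightFiltration (v : EuclideanSpace ℝ (Fin d)) :
    IsSublevelFiltration M.faces (simplexHeight v) (heightFiltration M v) := by
  intro r s
  refine and_congr_right fun hs => ?_
  rw [simplexHeight_le_iff (M.nonempty_of_mem_faces hs)]
  refine ⟨fun h x hx => h x (subset_convexHull ℝ _ hx), fun h x hx => ?_⟩
  have hconv : Convex ℝ {x : EuclideanSpace ℝ (Fin d) | inner ℝ x v ≤ r} :=
    convex_halfSpace_le ⟨fun _ _ => inner_add_left _ _ _, fun _ _ => real_inner_smul_left _ _ _⟩ r
  exact convexHull_min (fun x hx => h x hx) hconv hx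

variable {M}

/-- The heights in direction `v` are a coarsening of the heights in direction `w`. -/
def HeightsCoarsen (M : Geometry.SimplicialComplex ℝ (EuclideanSpace ℝ (Fin d)))
    (v w : EuclideanSpace ℝ (Fin d)) : Prop :=
  ∀ s ∈ M.faces, ∀ t ∈ M.faces, simplexHeight w s ≤ simplexHeight w t →
    simplexHeight v s ≤ simplexHeight v t

lemma eventually_heightsCoarsen (hM : M.faces.Finite) (v : EuclideanSpace ℝ (Fin d)) :
    ∀ᶠ w in 𝓝 v, HeightsCoarsen M v w := by
  unfold HeightsCoarsen
  rw [eventually_all_finite hM]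
  intro s hs
  rw [eventually_all_finite hM]
  intro t ht
  by_cases h : simplexHeight v s ≤ simplexHeight v t
  · exact Eventually.of_forall fun _ _ => h
  · have := (continuous_simplexHeight t).continuousAt.eventually_lt
      (continuous_simplexHeight s).continuousAt (not_le.1 h)
    exact this.mono fun w hw h' => absurd h' (not_le.2 hw)

/-- The two directions order the faces identically, so one pairing serves both and the same pairs
are off the diagonal. -/
lemma HeightsCoarsen.card_offDiagonal_eq (hM : M.faces.Finite) {v w : EuclideanSpace ℝ (Fin d)}
    (h₁ : HeightsCoarsen M v w) (h₂ : HeightsCoarsen M w v) (k : ℕ) :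
    ENat.card (heightDiagram M k v).OffDiagonal = ENat.card (heightDiagram M k w).OffDiagonal := by
  obtain ⟨I, _, σ, τ, hσ, hτ, hrep⟩ :=
    exists_pairing hM (isSublevelFiltration_heightFiltration M w) k
  have hv : (heightDiagram M k v).Represents fun x =>
      (simplexHeight v (σ x), (τ x).map (simplexHeight v)) :=
    hrep _ _ (isSublevelFiltration_heightFiltration M v) h₁
  have hw : (heightDiagram M k w).Represents fun x =>
      (simplexHeight w (σ x), (τ x).map (simplexHeight w)) :=
    hrep _ _ (isSublevelFiltration_heightFiltration M w) fun _ _ _ _ => id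
  rw [hv.card_offDiagonal, hw.card_offDiagonal]
  congr 1
  refine Nat.card_congr (Equiv.subtypeEquivRight fun x => ?_)
  have hx := hτ x
  generalize τ x = b at hx
  induction b with
  | top => simp
  | coe t =>
    rw [WithTop.map_coe, WithTop.map_coe, WithTop.coe_lt_coe, WithTop.coe_lt_coe, ← not_le,
      ← not_le]
    exact not_congr ⟨h₂ _ (hx t rfl).1 _ (hσ x), h₁ _ (hx t rfl).1 _ (hσ x)⟩

lemma heightsCoarsen_smul (v : EuclideanSpace ℝ (Fin d)) {c : ℝ} (hc : 0 < c) :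
    HeightsCoarsen M (c • v) v ∧ HeightsCoarsen M v (c • v) := by
  constructor <;> intro s hs t ht h <;>
  · rw [simplexHeight_smul (M.nonempty_of_mem_faces hs) v hc,
      simplexHeight_smul (M.nonempty_of_mem_faces ht) v hc, mul_le_mul_iff_right₀ hc] at *
    exact h

lemma exists_card_offDiagonal_le (hM : M.faces.Finite) (k : ℕ) :
    ∃ N : ℕ, ∀ v, ENat.card (heightDiagram M k v).OffDiagonal ≤ N := by
  have := hM.to_subtype
  have hfin : ∀ v, ∃ n : ℕ, ENat.card (heightDiagram M k v).OffDiagonal = n := fun v => by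
    obtain ⟨I, _, σ, τ, -, -, hrep⟩ :=
      exists_pairing hM (isSublevelFiltration_heightFiltration M v) k
    have hv : (heightDiagram M k v).Represents fun x =>
        (simplexHeight v (σ x), (τ x).map (simplexHeight v)) :=
      hrep _ _ (isSublevelFiltration_heightFiltration M v) fun _ _ _ _ => id
    exact ⟨_, hv.card_offDiagonal⟩
  choose n hn using hfin
  -- The order pattern of the faces: it takes finitely many values and determines the number of
  -- points.
  let R : EuclideanSpace ℝ (Fin d) → Set (M.faces × M.faces) := fun v =>
    {q | simplexHeight v q.1.1 ≤ simplexHeight v q.2.1}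
  have hR : ∀ v w, R v = R w → n v = n w := fun v w h => by
    have h' : ∀ s (hs : s ∈ M.faces) t (ht : t ∈ M.faces),
        simplexHeight v s ≤ simplexHeight v t ↔ simplexHeight w s ≤ simplexHeight w t :=
      fun s hs t ht => Set.ext_iff.1 h (⟨s, hs⟩, ⟨t, ht⟩)
    have := HeightsCoarsen.card_offDiagonal_eq hM (v := v) (w := w)
      (fun s hs t ht => (h' s hs t ht).2) (fun s hs t ht => (h' s hs t ht).1) k
    rw [hn, hn] at this
    exact_mod_cast this
  have hrange : (Set.range n).Finite := by
    refine ((Set.toFinite (Set.range R)).image fun r => n (Function.invFun R r)).subset ?_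
    rintro _ ⟨v, rfl⟩
    exact ⟨R v, ⟨v, rfl⟩, hR _ _ (Function.invFun_eq ⟨v, rfl⟩)⟩
  obtain ⟨N, hN⟩ := hrange.bddAbove
  exact ⟨N, fun v => by rw [hn]; exact_mod_cast hN ⟨v, rfl⟩⟩

/-- The pairing is taken at the finer direction `w`, so only there is the bound `N` needed. The
factor `2` accounts for birth and death. -/
lemma HeightsCoarsen.edist_heightDiagram_le (hM : M.faces.Finite) {k N : ℕ} {K : ℝ≥0}
    (hK : ∀ x ∈ M.space, ‖x‖ ≤ K) {v w : EuclideanSpace ℝ (Fin d)} (h : HeightsCoarsen M v w)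
    (hN : ENat.card (heightDiagram M k w).OffDiagonal ≤ N) :
    edist (heightDiagram M k w) (heightDiagram M k v) ≤ N * (2 * K * edist w v) := by
  obtain ⟨I, _, σ, τ, hσ, hτ, hrep⟩ :=
    exists_pairing hM (isSublevelFiltration_heightFiltration M w) k
  have hv : (heightDiagram M k v).Represents fun x =>
      (simplexHeight v (σ x), (τ x).map (simplexHeight v)) :=
    hrep _ _ (isSublevelFiltration_heightFiltration M v) h
  have hw : (heightDiagram M k w).Represents fun x =>
      (simplexHeight w (σ x), (τ x).map (simplexHeight w)) :=
    hrep _ _ (isSublevelFiltration_heightFiltration M w) fun _ _ _ _ => id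
  have hmove : ∀ s ∈ M.faces,
      edist (simplexHeight w s) (simplexHeight v s) ≤ K * edist w v := fun s hs =>
    edist_simplexHeight_le (M.nonempty_of_mem_faces hs)
      (fun x hx => hK x (M.convexHull_subset_space hs (subset_convexHull ℝ _ hx))) w v
  refine edist_le_mul hw hv (fun x => ?_) (fun x => ?_) (fun x => ?_) (fun x => ?_) hN <;>
    have hx := hτ x <;> have hxσ := hσ x <;> generalize τ x = b at hx <;> cases b
  · exact le_top
  · exact WithTop.coe_le_coe.2 (hx _ rfl).2
  · exact le_top
  · exact WithTop.coe_le_coe.2 (h _ hxσ _ (hx _ rfl).1 (hx _ rfl).2)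
  · exact fun _ => WithTop.coe_lt_top _
  · rw [WithTop.map_coe, WithTop.map_coe, WithTop.coe_lt_coe, WithTop.coe_lt_coe]
    intro hlt
    by_contra hcon
    exact hlt.not_ge (h _ (hx _ rfl).1 _ hxσ (not_lt.1 hcon))
  · rw [mul_assoc, two_mul]
    exact add_le_add (hmove _ hxσ) zero_le
  · rw [mul_assoc, two_mul]
    exact add_le_add (hmove _ hxσ) (hmove _ (hx _ rfl).1)

end HeightFunction

/-! ### From the local estimate to the global one. -/

/-- A path that at each time moves with speed at most `C` covers at most the distance `C` in a
unit of time. -/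
lemma edist_zero_one_le_of_eventually {E : Type*} [PseudoEMetricSpace E] (f : ℝ → E) (C : ℝ≥0)
    (h : ∀ t, ∀ᶠ s in 𝓝 t, edist (f s) (f t) ≤ C * edist s t) : edist (f 0) (f 1) ≤ C := by
  have hf : Continuous f := continuous_iff_continuousAt.2 fun t => by
    rw [ContinuousAt, tendsto_iff_edist_tendsto_0]
    have h0 : Tendsto (fun s => (C : ℝ≥0∞) * edist s t) (𝓝 t) (𝓝 0) := by
      have h1 : Continuous fun s : ℝ => (C : ℝ≥0∞) * edist s t :=
        (ENNReal.continuous_const_mul ENNReal.coe_ne_top).comp (by fun_prop)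
      simpa using h1.tendsto t
    exact tendsto_of_tendsto_of_tendsto_of_le_of_le' tendsto_const_nhds h0
      (Eventually.of_forall fun _ => zero_le) (h t)
  let A : Set ℝ := {t | edist (f 0) (f t) ≤ C * ENNReal.ofReal t}
  have hA : IsClosed A := isClosed_le (by fun_prop)
    ((ENNReal.continuous_const_mul ENNReal.coe_ne_top).comp ENNReal.continuous_ofReal)
  have hsub : Set.Icc (0 : ℝ) 1 ⊆ A := by
    -- Continuous induction: the closed set `A` contains `0` and can be continued to the right from
    -- each of its points in `[0, 1)`.
    refine (hA.inter isClosed_Icc).Icc_subset_of_forall_exists_gt (by simp [A]) ?_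
    rintro t ⟨htA, ht⟩ y hy
    have h1 : ∀ᶠ s in 𝓝[>] t, edist (f s) (f t) ≤ C * edist s t := nhdsWithin_le_nhds (h t)
    obtain ⟨s, hs, hs'⟩ := (h1.and (Ioc_mem_nhdsGT hy)).exists
    refine ⟨s, ?_, hs'⟩
    calc edist (f 0) (f s) ≤ edist (f 0) (f t) + edist (f s) (f t) := by
          rw [edist_comm (f s)]
          exact edist_triangle _ _ _
      _ ≤ C * ENNReal.ofReal t + C * edist s t := add_le_add htA hs
      _ = C * ENNReal.ofReal s := by
          rw [← mul_add, edist_dist, Real.dist_eq, abs_of_pos (sub_pos.2 hs'.1),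
            ← ENNReal.ofReal_add ht.1 (sub_pos.2 hs'.1).le, add_sub_cancel]
  simpa [A] using hsub (Set.right_mem_Icc.2 zero_le_one)

theorem lipschitzWith_heightDiagram {d : ℕ}
    {M : Geometry.SimplicialComplex ℝ (EuclideanSpace ℝ (Fin d))} (hM : M.faces.Finite)
    {k N : ℕ} {K : ℝ≥0}
    (hN : ∀ v : Metric.sphere (0 : EuclideanSpace ℝ (Fin d)) 1,
      ENat.card (heightDiagram M k v).OffDiagonal ≤ N)
    (hK : ∀ x ∈ M.space, ‖x‖ ≤ K) :
    LipschitzWith (2 * N * K)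
      (fun v : Metric.sphere (0 : EuclideanSpace ℝ (Fin d)) 1 => heightDiagram M k v) := by
  have hN' : ∀ w : EuclideanSpace ℝ (Fin d), w ≠ 0 →
      ENat.card (heightDiagram M k w).OffDiagonal ≤ N := fun w hw => by
    have hc : 0 < ‖w‖⁻¹ := inv_pos.2 (norm_pos_iff.2 hw)
    have hu : ‖w‖⁻¹ • w ∈ Metric.sphere (0 : EuclideanSpace ℝ (Fin d)) 1 := by
      rw [mem_sphere_zero_iff_norm]
      rw [norm_smul, norm_inv, norm_norm, inv_mul_cancel₀ (norm_ne_zero_iff.2 hw)]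
    have h := heightsCoarsen_smul (M := M) w hc
    rw [h.2.card_offDiagonal_eq hM h.1]
    exact hN ⟨_, hu⟩
  intro v₁ v₂
  rcases eq_or_ne v₁ v₂ with rfl | hne
  · simp
  have hne' : (v₁ : EuclideanSpace ℝ (Fin d)) ≠ v₂ := fun h => hne (Subtype.ext h)
  -- The chord, unlike an arc of the sphere, has length exactly `‖v₁ - v₂‖`.
  let γ : ℝ → EuclideanSpace ℝ (Fin d) := fun t => AffineMap.lineMap v₁.1 v₂.1 t
  have hγ : Continuous γ := AffineMap.lineMap_continuous
  have hinj : Function.Injective γ := AffineMap.lineMap_injective ℝ hne'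
  have hγd : ∀ s t, edist (γ s) (γ t) = edist s t * nndist v₁ v₂ := fun s t => by
    rw [edist_nndist, edist_nndist, ← ENNReal.coe_mul, ENNReal.coe_inj]
    exact nndist_lineMap_lineMap _ _ _ _
  have key := edist_zero_one_le_of_eventually (fun t => heightDiagram M k (γ t))
    (2 * N * K * nndist v₁ v₂) fun t => by
      have h1 := (hγ.tendsto t).eventually (eventually_heightsCoarsen hM (γ t))
      -- For antipodal points the chord meets the origin, where `hN'` says nothing. The local
      -- estimate needs the bound only at `γ s`, and by injectivity `γ s ≠ 0` even if `γ t = 0`.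
      have h2 : ∀ᶠ s in 𝓝 t, s ≠ t → γ s ≠ 0 := by
        by_cases h0 : γ t = 0
        · exact Eventually.of_forall fun s hst hs => hst (hinj (hs.trans h0.symm))
        · exact (hγ.continuousAt.eventually_ne h0).mono fun s hs _ => hs
      filter_upwards [h1, h2] with s hs hs'
      rcases eq_or_ne s t with rfl | hst
      · simp
      refine (hs.edist_heightDiagram_le hM hK (hN' _ (hs' hst))).trans (le_of_eq ?_)
      rw [hγd]
      push_cast
      ring
  simp only [γ, AffineMap.lineMap_apply_zero, AffineMap.lineMap_apply_one] at key
  rw [edist_nndist v₁ v₂]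
  exact_mod_cast key

end PHT

end

theorem lemma2p1 (d : ℕ) (M : Geometry.SimplicialComplex ℝ (EuclideanSpace ℝ (Fin d)))
    (hM : M.faces.Finite) (k : ℕ) :
    (∃ N : ℕ, ∀ v : Metric.sphere (0 : EuclideanSpace ℝ (Fin d)) 1,
      ENat.card (PHT.heightDiagram M k v).OffDiagonal ≤ N) ∧
    (∃ K : NNReal, ∀ x ∈ M.space, ‖x‖ ≤ K) ∧
    (∀ (N : ℕ) (K : NNReal),
      (∀ v : Metric.sphere (0 : EuclideanSpace ℝ (Fin d)) 1,
        ENat.card (PHT.heightDiagram M k v).OffDiagonal ≤ N) →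
      (∀ x ∈ M.space, ‖x‖ ≤ K) →
      LipschitzWith (2 * N * K)
        (fun v : Metric.sphere (0 : EuclideanSpace ℝ (Fin d)) 1 => PHT.heightDiagram M k v)) ∧
    (∃ L : NNReal, LipschitzWith L
      (fun v : Metric.sphere (0 : EuclideanSpace ℝ (Fin d)) 1 => PHT.heightDiagram M k v)) ∧
    Continuous
      (fun v : Metric.sphere (0 : EuclideanSpace ℝ (Fin d)) 1 => PHT.heightDiagram M k v) := by
  obtain ⟨N, hN⟩ := PHT.exists_card_offDiagonal_le hM k
  have hK : ∃ K : NNReal, ∀ x ∈ M.space, ‖x‖ ≤ K := by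
    have hb : Bornology.IsBounded M.space := by
      rw [Geometry.SimplicialComplex.space, Bornology.isBounded_biUnion hM]
      exact fun s _ => isBounded_convexHull.2 s.finite_toSet.isBounded
    obtain ⟨C, hC⟩ := hb.exists_norm_le
    exact ⟨C.toNNReal, fun x hx => (hC x hx).trans (Real.le_coe_toNNReal C)⟩
  obtain ⟨K, hK⟩ := hK
  have hL := PHT.lipschitzWith_heightDiagram hM (k := k) (fun v => hN v) hK
  exact ⟨⟨N, fun v => hN v⟩, ⟨K, hK⟩,
    fun N K hN hK => PHT.lipschitzWith_heightDiagram hM hN hK, ⟨_, hL⟩, hL.continuous⟩
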